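/- Let $(\bar M,\bar g)$ be a smooth Lorentzian manifold of dimension $n+2$ (signature $(-,+,\dots,+)$) with Levi-Civita connection $\bar\nabla$, and let $M$ be an $(n+1)$-dimensional manifold immersed in $\bar M$ whose induced metric $g$ is degenerate, with one-dimensional radical $\mathrm{rad}(T_pM)=T_pM\cap T_pM^{\perp}$. Let $S(TM)$ be a screen distribution, i.e. a smooth rank-$n$ subbundle of $TM$ with $TM=S(TM)\oplus\mathrm{rad}(TM)$, and assume that $S(TM)$ is integrable. A null frame is a pair $\{\xi,N\}$ of a smooth section $\xi$ of $\mathrm{rad}(TM)$ and a smooth vector field $N$ along $M$ with values in $T\bar M$ such that $\bar g(\xi,N)=1$, $\bar g(N,N)=0$ and $\bar g(N,X)=0$ for all $X\in S(TM)$. For a vector field $Y$ of $\bar M$ along $M$, write $Y=Y^*+Y^\perp$ for its decomposition along $T\bar M|_M=S(TM)\oplus S(TM)^\perp$; for a section $V$ of $S(TM)^\perp$, let $A_V$ be the shape operator of $S(TM)$, given for $X\in S(TM)$ by $A_VX=-(\bar\nabla_XV)^*$. Put $|V|=\sqrt{|\bar g(V,V)|}$ and $\measuredangle(V,W)=\bar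 g(V,W)/|V|$. The null hypersurface $(M,g,S(TM))$ has constant angle with respect to a vector field $V$ along $M$ if $\bar g(V,V)$ vanishes nowhere on $M$ and there is a null frame $\{\xi,N\}$ for which both functions $\measuredangle(V,\xi)$ and $\measuredangle(V,N)$ are constant on $M$. Theorem. Let $Z$ be a smooth closed conformal vector field on $\bar M$, i.e. $\bar\nabla_XZ=\varphi X$ for all $X\in T\bar M$, for a smooth function $\varphi$ on $\bar M$. If $(M,g,S(TM))$ has constant angle with respect to $Z$, then $Z$ is a canonical principal direction with respect to $A_{Z^\perp}$: there is a smooth function $\mu$ on $M$ such that, at every point where $Z^*\neq0$, the vector $Z^*$ is an eigenvector of $A_{Z^\perp}$ with eigenvalue $\mu$. Moreover, for every null frame $\{\xi,N\}$, everywhere on $M$, $$A_{Z^\perp}Z^*=-2\,\varepsilon_Z\,\measuredangle(Z,\xi)\,\measuredangle(Z,N)\,\varphi\,Z^*,$$ where $\varepsilon_Z=\pm1$ is the sign of $\bar g(Z,Z)$. -/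

import Mathlib

open Bundle Manifold
open scoped Manifold ContDiff Topology

set_option maxSynthPendingDepth 3

noncomputable section

/-- The model space `ℝ^m`. -/
abbrev Model (m : ℕ) : Type := EuclideanSpace ℝ (Fin m)

/-! ### Lorentzian metrics and the Levi-Civita connection -/

/-- The trilinear map `½ (D(u)(v, w) + D(v)(u, w) - D(w)(u, v))`; see `koszul_apply`. -/
def koszul {E : Type*} [NormedAddCommGroup E] [NormedSpace ℝ E]
    (D : E →L[ℝ] E →L[ℝ] E →L[ℝ] ℝ) : E →L[ℝ] E →L[ℝ] E →L[ℝ] ℝ :=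
  (1 / 2 : ℝ) • (D + D.flip -
    (ContinuousLinearMap.flipₗᵢ ℝ E E ℝ).toContinuousLinearEquiv.toContinuousLinearMap ∘L D.flip)

theorem koszul_apply {E : Type*} [NormedAddCommGroup E] [NormedSpace ℝ E]
    (D : E →L[ℝ] E →L[ℝ] E →L[ℝ] ℝ) (u v w : E) :
    koszul D u v w = (1 / 2) * (D u v w + D v u w - D w u v) := by
  simp [koszul]

/-- For a nondegenerate bilinear form `G`, the map `(u, v) ↦ Γ(u, v)` with
`G(Γ(u, v), w) = T(u, v, w)`. -/
def raiseIndex {E : Type*} [NormedAddCommGroup E] [NormedSpace ℝ E]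
    (G : E →L[ℝ] E →L[ℝ] ℝ) (T : E →L[ℝ] E →L[ℝ] E →L[ℝ] ℝ) : E →L[ℝ] E →L[ℝ] E :=
  (ContinuousLinearMap.compL ℝ E (E →L[ℝ] ℝ) E G.inverse) ∘L T

theorem raiseIndex_spec {E : Type*} [NormedAddCommGroup E] [NormedSpace ℝ E]
    [FiniteDimensional ℝ E] (G : E →L[ℝ] E →L[ℝ] ℝ) (hG : Function.Injective G)
    (T : E →L[ℝ] E →L[ℝ] E →L[ℝ] ℝ) (u v w : E) :
    G (raiseIndex G T u v) w = T u v w := by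
  let e₀ : E ≃ₗ[ℝ] (E →L[ℝ] ℝ) :=
    LinearEquiv.ofInjectiveOfFinrankEq (G : E →ₗ[ℝ] _) hG (by
      rw [← (LinearMap.toContinuousLinearMap (𝕜 := ℝ) (E := E) (F' := ℝ)).finrank_eq]
      exact (Subspace.dual_finrank_eq (K := ℝ) (V := E)).symm)
  have he : G = (e₀.toContinuousLinearEquiv : E →L[ℝ] _) := by
    ext a; rfl
  change G (G.inverse (T u v)) w = _
  conv_lhs => rw [he, ContinuousLinearMap.inverse_equiv]
  simp

/-- A smooth Lorentzian metric, of signature `(-, +, …, +)`, on an `(n+2)`-manifold. -/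
structure LorentzMetric (n : ℕ) (Mbar : Type*) [TopologicalSpace Mbar]
    [ChartedSpace (Model (n + 2)) Mbar] [IsManifold (𝓡 (n + 2)) ∞ Mbar] where
  /-- the scalar product on each tangent space -/
  form (q : Mbar) :
    TangentSpace (𝓡 (n + 2)) q →L[ℝ] TangentSpace (𝓡 (n + 2)) q →L[ℝ] ℝ
  symm (q : Mbar) (u v : TangentSpace (𝓡 (n + 2)) q) : form q u v = form q v u
  /-- there is an orthonormal basis with exactly one timelike vector -/
  lorentz (q : Mbar) : ∃ b : Module.Basis (Fin (n + 2)) ℝ (TangentSpace (𝓡 (n + 2)) q),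
    ∀ i j, form q (b i) (b j) = if i = j then (if i = 0 then -1 else 1) else 0
  smooth : ContMDiff (𝓡 (n + 2))
    ((𝓡 (n + 2)).prod 𝓘(ℝ, Model (n + 2) →L[ℝ] Model (n + 2) →L[ℝ] ℝ)) ∞
    (fun q ↦ TotalSpace.mk' (Model (n + 2) →L[ℝ] Model (n + 2) →L[ℝ] ℝ) q (form q))

namespace LorentzMetric

variable {n : ℕ} {Mbar : Type*} [TopologicalSpace Mbar]
  [ChartedSpace (Model (n + 2)) Mbar] [IsManifold (𝓡 (n + 2)) ∞ Mbar]
  (g : LorentzMetric n Mbar)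

/-- The trivialization of the tangent bundle by the coordinate frame of the preferred chart
at `q₀`. -/
abbrev coordTriv (q₀ : Mbar) :=
  trivializationAt (Model (n + 2)) (TangentSpace (𝓡 (n + 2)) : Mbar → Type _) q₀

/-- The metric coefficients `g_{ij}` in the chart at `q₀`, as a function of the coordinates `y`
with values in the bilinear forms on `ℝ^(n+2)`. -/
def inChart (q₀ : Mbar) (y : Model (n + 2)) :
    Model (n + 2) →L[ℝ] Model (n + 2) →L[ℝ] ℝ :=
  let s := (coordTriv (n := n) q₀).symmL ℝ ((extChartAt (𝓡 (n + 2)) q₀).symm y)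
  (s.precomp ℝ) ∘L (g.form ((extChartAt (𝓡 (n + 2)) q₀).symm y)) ∘L s

/-- The derivative `(w, u, v) ↦ ∂_w g(u, v)` of the metric coefficients, at the centre `q₀` of the
chart. -/
def dInChart (q₀ : Mbar) :
    Model (n + 2) →L[ℝ] Model (n + 2) →L[ℝ] Model (n + 2) →L[ℝ] ℝ :=
  fderiv ℝ (g.inChart q₀) (extChartAt (𝓡 (n + 2)) q₀ q₀)

/-- The Christoffel symbols at `q₀`, in the chart at `q₀`: the bilinear map `Γ` with
`g (Γ (u, v), w) = ½ (∂_u g(v, w) + ∂_v g(u, w) - ∂_w g(u, v))`; see `inChart_christoffel`. -/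
def christoffel (q₀ : Mbar) : Model (n + 2) →L[ℝ] Model (n + 2) →L[ℝ] Model (n + 2) :=
  raiseIndex (g.inChart q₀ (extChartAt (𝓡 (n + 2)) q₀ q₀)) (koszul (g.dInChart q₀))

theorem form_nondegenerate (q : Mbar) (u : TangentSpace (𝓡 (n + 2)) q)
    (hu : ∀ v, g.form q u v = 0) : u = 0 := by
  obtain ⟨b, hb⟩ := g.lorentz q
  have h : ∀ j, b.repr u j = 0 := by
    intro j
    have h1 := hu (b j)
    rw [← b.sum_repr u] at h1
    simp only [map_sum, map_smul, sum_apply,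
      smul_apply, hb, smul_eq_mul, mul_ite, mul_zero] at h1
    rw [Finset.sum_ite_eq' Finset.univ j] at h1
    by_cases hj : j = 0 <;> simpa [hj] using h1
  exact b.ext_elem (fun j ↦ by simpa using h j)

theorem inChart_christoffel (q₀ : Mbar) (u v w : Model (n + 2)) :
    g.inChart q₀ (extChartAt (𝓡 (n + 2)) q₀ q₀) (g.christoffel q₀ u v) w =
      (1 / 2) * (g.dInChart q₀ u v w + g.dInChart q₀ v u w - g.dInChart q₀ w u v) := by
  rw [← koszul_apply]
  refine raiseIndex_spec _ ?_ _ u v w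
  rw [injective_iff_map_eq_zero]
  intro a ha
  have hmem : (extChartAt (𝓡 (n + 2)) q₀).symm (extChartAt (𝓡 (n + 2)) q₀ q₀) ∈
      (coordTriv (n := n) q₀).baseSet := by
    rw [extChartAt_to_inv q₀]; exact FiberBundle.mem_baseSet_trivializationAt' q₀
  have h0 : (coordTriv (n := n) q₀).symmL ℝ
      ((extChartAt (𝓡 (n + 2)) q₀).symm (extChartAt (𝓡 (n + 2)) q₀ q₀)) a = 0 := by
    apply g.form_nondegenerate
    intro v
    have h1 := congrArg (fun L : Model (n + 2) →L[ℝ] ℝ ↦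
      L ((coordTriv (n := n) q₀).continuousLinearMapAt ℝ _ v)) ha
    have h2 := (coordTriv (n := n) q₀).symmL_continuousLinearMapAt (R := ℝ) hmem v
    rw [← h2]
    exact h1
  have h2 := congrArg ((coordTriv (n := n) q₀).continuousLinearMapAt ℝ _) h0
  rwa [Trivialization.continuousLinearMapAt_symmL _ hmem, map_zero] at h2

variable {k : ℕ} {L : Type*} [TopologicalSpace L] [ChartedSpace (Model k) L]

/-- The Levi-Civita covariant derivative `X ↦ ∇̄_X V` at `p` of a vector field `V` along a map
`f : L → Mbar`: in the chart at `f p` it is `X ↦ dV(X) + Γ(df(X), V)`. -/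
def covDeriv (f : L → Mbar) (V : (p : L) → TangentSpace (𝓡 (n + 2)) (f p)) (p : L) :
    TangentSpace (𝓡 k) p →L[ℝ] TangentSpace (𝓡 (n + 2)) (f p) :=
  let e := coordTriv (n := n) (f p)
  let dV : TangentSpace (𝓡 k) p →L[ℝ] Model (n + 2) :=
    mfderiv (𝓡 k) 𝓘(ℝ, Model (n + 2))
      (fun p' ↦ (e (TotalSpace.mk' (Model (n + 2)) (f p') (V p'))).2) p
  let df : TangentSpace (𝓡 k) p →L[ℝ] Model (n + 2) :=
    (e.continuousLinearMapAt ℝ (f p)) ∘L mfderiv (𝓡 k) (𝓡 (n + 2)) f p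
  (e.symmL ℝ (f p)) ∘L
    (dV + (g.christoffel (f p)).flip (e.continuousLinearMapAt ℝ (f p) (V p)) ∘L df)

/-- The length `|v| = √|g(v, v)|`. -/
def length {q : Mbar} (v : TangentSpace (𝓡 (n + 2)) q) : ℝ := √|g.form q v v|

/-- The angle function `∡(v, w) = g(v, w) / |v|`, for a non-null vector `v`. -/
def angle {q : Mbar} (v w : TangentSpace (𝓡 (n + 2)) q) : ℝ := g.form q v w / g.length v

/-- `Z` is a (smooth) closed conformal vector field with associated smooth function `φ`:
`∇̄_X Z = φ X` for all `X`. -/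
structure IsClosedConformal (Z : (q : Mbar) → TangentSpace (𝓡 (n + 2)) q) (φ : Mbar → ℝ) :
    Prop where
  smooth_field : ContMDiff (𝓡 (n + 2)) (𝓡 (n + 2)).tangent ∞
    (fun q ↦ (TotalSpace.mk' (Model (n + 2)) q (Z q) : TangentBundle (𝓡 (n + 2)) Mbar))
  smooth_fun : ContMDiff (𝓡 (n + 2)) 𝓘(ℝ, ℝ) ∞ φ
  covDeriv_eq (q : Mbar) (X : TangentSpace (𝓡 (n + 2)) q) :
    g.covDeriv (k := n + 2) (fun q' ↦ q') Z q X = φ q • X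

variable {M : Type*} [TopologicalSpace M] [ChartedSpace (Model (n + 1)) M]

/-- The metric induced on `M` by a map `f : M → Mbar`. -/
def induced (f : M → Mbar) (p : M) :
    TangentSpace (𝓡 (n + 1)) p →L[ℝ] TangentSpace (𝓡 (n + 1)) p →L[ℝ] ℝ :=
  ((mfderiv (𝓡 (n + 1)) (𝓡 (n + 2)) f p).precomp ℝ) ∘L (g.form (f p)) ∘L
    (mfderiv (𝓡 (n + 1)) (𝓡 (n + 2)) f p)

/-- The radical `rad(T_pM) = T_pM ∩ T_pM^⊥` of the induced metric. -/
def radical (f : M → Mbar) (p : M) : Submodule ℝ (TangentSpace (𝓡 (n + 1)) p) where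
  carrier := {v | ∀ w, g.induced f p v w = 0}
  add_mem' {a b} ha hb := by
    intro w; simp [ha w, hb w]
  zero_mem' := by
    intro w; simp
  smul_mem' c a ha := by
    intro w; simp [ha w]

end LorentzMetric

/-! ### Null hypersurfaces -/

/-- A null hypersurface `(M, g, S(TM))`: an `(n+1)`-manifold `M` immersed in the
`(n+2)`-dimensional Lorentzian manifold `Mbar`, with degenerate induced metric, together with a
screen distribution, i.e. a smooth subbundle `S(TM)` of `TM`, of rank `n`, complementary to the
radical bundle. (As the rank of the screen is `n`, the radical is a line, so that the induced
metric is indeed degenerate.) -/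
structure NullHypersurface {n : ℕ} {Mbar : Type*} [TopologicalSpace Mbar]
    [ChartedSpace (Model (n + 2)) Mbar] [IsManifold (𝓡 (n + 2)) ∞ Mbar]
    (g : LorentzMetric n Mbar) (M : Type*) [TopologicalSpace M]
    [ChartedSpace (Model (n + 1)) M] [IsManifold (𝓡 (n + 1)) ∞ M] where
  /-- the immersion -/
  imm : M → Mbar
  isImmersion : IsImmersion (𝓡 (n + 1)) (𝓡 (n + 2)) ∞ imm
  /-- the screen distribution `S(TM)` -/
  screen (p : M) : Submodule ℝ (TangentSpace (𝓡 (n + 1)) p)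
  /-- `S(TM)` has smooth local frames consisting of `n` vector fields -/
  smooth_screen (p : M) : ∃ U : Set M, IsOpen U ∧ p ∈ U ∧
    ∃ e : Fin n → (q : M) → TangentSpace (𝓡 (n + 1)) q,
      (∀ a, ContMDiffOn (𝓡 (n + 1)) (𝓡 (n + 1)).tangent ∞
        (fun q ↦ (TotalSpace.mk' (Model (n + 1)) q (e a q) : TangentBundle (𝓡 (n + 1)) M)) U) ∧
      ∀ q ∈ U, LinearIndependent ℝ (fun a ↦ e a q) ∧
        Submodule.span ℝ (Set.range fun a ↦ e a q) = screen q
  isCompl_screen_radical (p : M) : IsCompl (screen p) (g.radical imm p)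

namespace NullHypersurface

variable {n : ℕ} {Mbar : Type*} [TopologicalSpace Mbar]
  [ChartedSpace (Model (n + 2)) Mbar] [IsManifold (𝓡 (n + 2)) ∞ Mbar]
  {g : LorentzMetric n Mbar} {M : Type*} [TopologicalSpace M]
  [ChartedSpace (Model (n + 1)) M] [IsManifold (𝓡 (n + 1)) ∞ M]
  (H : NullHypersurface g M)

/-- Push-forward of tangent vectors of `M` to the ambient manifold. -/
abbrev push (p : M) : TangentSpace (𝓡 (n + 1)) p →L[ℝ] TangentSpace (𝓡 (n + 2)) (H.imm p) :=
  mfderiv (𝓡 (n + 1)) (𝓡 (n + 2)) H.imm p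

/-- `S(TM)` is integrable: through each point `p` of `M` there passes an integral manifold (a leaf)
of it, here given by an immersion `j` of an open set of `ℝ^n` whose tangent spaces are the fibres
of `S(TM)`. -/
def IsScreenIntegrable : Prop :=
  ∀ p : M, ∃ (U : Set (Model n)) (u₀ : Model n) (j : Model n → M),
    IsOpen U ∧ u₀ ∈ U ∧ j u₀ = p ∧ ContMDiffOn (𝓡 n) (𝓡 (n + 1)) ∞ j U ∧
    ∀ u ∈ U, Function.Injective (mfderiv (𝓡 n) (𝓡 (n + 1)) j u) ∧
      Set.range (mfderiv (𝓡 n) (𝓡 (n + 1)) j u) = (H.screen (j u) : Set _)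

/-- The metric on the fibre of the screen distribution. -/
def screenForm (p : M) : LinearMap.BilinForm ℝ (H.screen p) :=
  LinearMap.mk₂ ℝ (fun s t ↦ g.induced H.imm p (s : TangentSpace (𝓡 (n + 1)) p) t)
    (by intros; simp) (by intros; simp) (by intros; simp) (by intros; simp)

theorem screenForm_nondegenerate (p : M) : (H.screenForm p).Nondegenerate := by
  have hsymm : (H.screenForm p).IsSymm := ⟨fun s t ↦ g.symm _ _ _⟩
  have hl : (H.screenForm p).SeparatingLeft := by
    intro s hs
    have hcompl := H.isCompl_screen_radical p
    have hrad : (s : TangentSpace (𝓡 (n + 1)) p) ∈ g.radical H.imm p := by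
      intro w
      have hw : w ∈ H.screen p ⊔ g.radical H.imm p := by
        rw [hcompl.sup_eq_top]; trivial
      obtain ⟨a, ha, b, hb, rfl⟩ := Submodule.mem_sup.1 hw
      have h1 : g.induced H.imm p s a = 0 := hs ⟨a, ha⟩
      have h2 : g.induced H.imm p s b = 0 := by
        rw [← hb (s : TangentSpace (𝓡 (n + 1)) p)]; exact g.symm _ _ _
      rw [map_add, h1, h2, add_zero]
    have := (Submodule.disjoint_def.1 hcompl.disjoint) _ s.2 hrad
    exact Subtype.ext this
  exact ⟨hl, fun t ht ↦ hl t fun s ↦ by rw [← ht s]; exact g.symm _ _ _⟩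

instance finiteDimensional_screen (p : M) : FiniteDimensional ℝ (H.screen p) :=
  haveI : FiniteDimensional ℝ (TangentSpace (𝓡 (n + 1)) p) :=
    inferInstanceAs (FiniteDimensional ℝ (Model (n + 1)))
  inferInstance

/-- The projection of `T_pMbar = S(TM)_p ⊕ S(TM)_p^⊥` onto `S(TM)_p`: it sends `Y` to the unique
vector of the screen that has the same scalar products as `Y` with the vectors of the screen;
see `screenProj_spec`. -/
def screenProj (p : M) : TangentSpace (𝓡 (n + 2)) (H.imm p) →ₗ[ℝ] H.screen p :=
  ((H.screenForm p).toDual (H.screenForm_nondegenerate p)).symm.toLinearMap ∘ₗ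
    LinearMap.mk₂ ℝ (fun Y (s : H.screen p) ↦ g.form (H.imm p) Y (H.push p s))
      (by intros; simp) (by intros; simp) (by intros; simp) (by intros; simp)

theorem screenProj_spec (p : M) (Y : TangentSpace (𝓡 (n + 2)) (H.imm p)) (s : H.screen p) :
    g.form (H.imm p) (H.push p (H.screenProj p Y)) (H.push p s) =
      g.form (H.imm p) Y (H.push p s) := by
  have h := LinearMap.BilinForm.apply_toDual_symm_apply (hB := H.screenForm_nondegenerate p)
    (LinearMap.mk₂ ℝ (fun Y (s : H.screen p) ↦ g.form (H.imm p) Y (H.push p s))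
      (by intros; simp) (by intros; simp) (by intros; simp) (by intros; simp) Y) s
  exact h

/-- The component `Y^⊥` of `Y` in `S(TM)^⊥`. -/
def perp (p : M) (Y : TangentSpace (𝓡 (n + 2)) (H.imm p)) :
    TangentSpace (𝓡 (n + 2)) (H.imm p) :=
  Y - H.push p (H.screenProj p Y)

/-- The shape operator `A_V` of `S(TM)` with respect to a section `V` of `S(TM)^⊥`:
`A_V X` is minus the `S(TM)`-component of `∇̄_X V`. -/
def shapeOperator (V : (p : M) → TangentSpace (𝓡 (n + 2)) (H.imm p)) (p : M) :
    Module.End ℝ (H.screen p) :=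
  -(H.screenProj p ∘ₗ (g.covDeriv (k := n + 1) H.imm V p).toLinearMap ∘ₗ (H.screen p).subtype)

/-- A null frame `{ξ, N}`: smooth sections `ξ` of `rad(TM)` and `N` of the transversal bundle
`tr(TM)` with `g(ξ, N) = 1`, `g(N, N) = 0` and `g(N, X) = 0` for `X` in `S(TM)`. -/
structure IsNullFrame (ξ : (p : M) → TangentSpace (𝓡 (n + 1)) p)
    (N : (p : M) → TangentSpace (𝓡 (n + 2)) (H.imm p)) : Prop where
  smooth_xi : ContMDiff (𝓡 (n + 1)) (𝓡 (n + 1)).tangent ∞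
    (fun p ↦ (TotalSpace.mk' (Model (n + 1)) p (ξ p) : TangentBundle (𝓡 (n + 1)) M))
  smooth_N : ContMDiff (𝓡 (n + 1)) (𝓡 (n + 2)).tangent ∞
    (fun p ↦ (TotalSpace.mk' (Model (n + 2)) (H.imm p) (N p) :
      TangentBundle (𝓡 (n + 2)) Mbar))
  xi_mem (p : M) : ξ p ∈ g.radical H.imm p
  form_xi_N (p : M) : g.form (H.imm p) (H.push p (ξ p)) (N p) = 1
  form_N_N (p : M) : g.form (H.imm p) (N p) (N p) = 0
  form_N_screen (p : M) : ∀ X ∈ H.screen p, g.form (H.imm p) (N p) (H.push p X) = 0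

/-- `(M, g, S(TM))` has constant angle with respect to the vector field `V` along `M`: `V` is
nowhere null, and for some null frame `{ξ, N}` both angle functions are constant. -/
def HasConstantAngle (V : (p : M) → TangentSpace (𝓡 (n + 2)) (H.imm p)) : Prop :=
  (∀ p, g.form (H.imm p) (V p) (V p) ≠ 0) ∧
  ∃ ξ N, H.IsNullFrame ξ N ∧ ∃ a b : ℝ,
    ∀ p, g.angle (V p) (H.push p (ξ p)) = a ∧ g.angle (V p) (N p) = b

/-- `V` is a canonical principal direction for `A_{V^⊥}`: its screen component `V^*` is a principal
direction (an eigenvector wherever it does not vanish), with smooth principal curvature. -/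
def IsCanonicalPrincipalDirection (V : (p : M) → TangentSpace (𝓡 (n + 2)) (H.imm p)) : Prop :=
  ∃ μ : M → ℝ, ContMDiff (𝓡 (n + 1)) 𝓘(ℝ, ℝ) ∞ μ ∧
    ∀ p, H.screenProj p (V p) ≠ 0 →
      (H.shapeOperator (fun p' ↦ H.perp p' (V p')) p).HasEigenvector (μ p)
        (H.screenProj p (V p))

end NullHypersurface

end

/-! Write `c = 2ab`, with `a`, `b` the constant angles. Since `ξ` and `N` are null with `g(ξ, N) =
1`, `Z^⊥ = g(Z, N) ξ + g(Z, ξ) N`, so `g(Z^⊥, Z^⊥) = 2 g(Z, ξ) g(Z, N) = c |g(Z, Z)| = c ε g(Z, Z)`,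
where the sign `ε` is locally constant.

For `Y` in the screen, closed conformality gives `Y g(Z, Z) = 2φ g(Y, Z)`. Differentiating `g(Z^⊥,
Z^⊥)` yields `g(∇̄_Y Z^⊥, Z^⊥) = cεφ g(Y, Z)`. The same function is `g(Z^⊥, Z)`, and `g(Z^⊥, ∇̄_Y Z)
= 0`, so `g(∇̄_Y Z^⊥, Z) = 2cεφ g(Y, Z)`. Subtracting, `g(∇̄_Y Z^⊥, Z^*) = cεφ g(Y, Z^*)`.

Integrability makes the shape operator self-adjoint (`form_covDeriv_comm`), which turns this into `A
Z^* = -cεφ Z^*` (`shapeOperator_perp_of_isClosedConformal`). The formula holds for every null frame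
because the product of the two angles does not depend on the frame (`two_mul_angle_mul_angle`).
Metric compatibility and vanishing torsion are derived from the Christoffel symbols
(`differential_form`, `covDeriv_coordField_comm`). -/

noncomputable section

namespace LorentzMetric

variable {n : ℕ} {Mbar : Type*} [TopologicalSpace Mbar]
  [ChartedSpace (Model (n + 2)) Mbar] [IsManifold (𝓡 (n + 2)) ∞ Mbar]
  (g : LorentzMetric n Mbar)

/-! ### Smooth vector fields along a map -/

section Along

variable {k : ℕ} {L : Type*} [TopologicalSpace L] [ChartedSpace (Model k) L]

/-- The vector field `V` along `f` is smooth near `p`. -/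
def SmoothAlongAt (k : ℕ) {L : Type*} [TopologicalSpace L] [ChartedSpace (Model k) L]
    (f : L → Mbar) (V : (p : L) → TangentSpace (𝓡 (n + 2)) (f p)) (p : L) : Prop :=
  ContMDiffAt (𝓡 k) (𝓡 (n + 2)).tangent ∞
    (fun p ↦ (TotalSpace.mk' (Model (n + 2)) (f p) (V p) : TangentBundle (𝓡 (n + 2)) Mbar)) p

/-- The components of the vector field `V` along `f` in the coordinate frame of the chart at
`f p`. -/
def coord (f : L → Mbar) (V : (p : L) → TangentSpace (𝓡 (n + 2)) (f p)) (p p' : L) :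
    Model (n + 2) :=
  (coordTriv (n := n) (f p)).continuousLinearMapAt ℝ (f p') (V p')

variable {f : L → Mbar} {V W : (p : L) → TangentSpace (𝓡 (n + 2)) (f p)} {p : L}

theorem mem_baseSet_coordTriv {q₀ q : Mbar} :
    q ∈ (coordTriv (n := n) q₀).baseSet ↔ q ∈ (chartAt (Model (n + 2)) q₀).source := by
  rw [TangentBundle.trivializationAt_baseSet]

/-- The two readings of the components agree only over the chart domain. `covDeriv` uses the left
one; `coord` is linear in `V` everywhere, which makes sums and multiples immediate. -/
theorem coord_eventuallyEq (hf : ContinuousAt f p) :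
    (fun p' ↦ (coordTriv (n := n) (f p) (TotalSpace.mk' (Model (n + 2)) (f p') (V p'))).2)
      =ᶠ[𝓝 p] coord f V p := by
  filter_upwards [hf.eventually_mem (chart_source_mem_nhds (Model (n + 2)) _)] with p' hp'
  rw [coord, Trivialization.continuousLinearMapAt_apply,
    Trivialization.coe_linearMapAt_of_mem _ (mem_baseSet_coordTriv.2 hp')]

theorem smoothAlongAt_iff : SmoothAlongAt k f V p ↔ ContMDiffAt (𝓡 k) (𝓡 (n + 2)) ∞ f p ∧
    ContMDiffAt (𝓡 k) 𝓘(ℝ, Model (n + 2)) ∞ (coord f V p) p := by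
  rw [SmoothAlongAt, contMDiffAt_totalSpace]
  refine and_congr_right fun hf ↦ ?_
  exact (coord_eventuallyEq hf.continuousAt).contMDiffAt_iff

theorem SmoothAlongAt.contMDiffAt (h : SmoothAlongAt k f V p) :
    ContMDiffAt (𝓡 k) (𝓡 (n + 2)) ∞ f p := (smoothAlongAt_iff.1 h).1

theorem SmoothAlongAt.contMDiffAt_coord (h : SmoothAlongAt k f V p) :
    ContMDiffAt (𝓡 k) 𝓘(ℝ, Model (n + 2)) ∞ (coord f V p) p := (smoothAlongAt_iff.1 h).2

theorem SmoothAlongAt.mdifferentiableAt_coord (h : SmoothAlongAt k f V p) :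
    MDifferentiableAt (𝓡 k) 𝓘(ℝ, Model (n + 2)) (coord f V p) p :=
  h.contMDiffAt_coord.mdifferentiableAt (by simp)

theorem SmoothAlongAt.add (hV : SmoothAlongAt k f V p) (hW : SmoothAlongAt k f W p) :
    SmoothAlongAt k f (fun p ↦ V p + W p) p := by
  refine smoothAlongAt_iff.2 ⟨hV.contMDiffAt, ?_⟩
  have h := hV.contMDiffAt_coord.add hW.contMDiffAt_coord
  convert h using 1
  ext1 p'
  simp [coord]

theorem SmoothAlongAt.smul {c : L → ℝ} (hc : ContMDiffAt (𝓡 k) 𝓘(ℝ, ℝ) ∞ c p)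
    (hV : SmoothAlongAt k f V p) : SmoothAlongAt k f (fun p ↦ c p • V p) p := by
  refine smoothAlongAt_iff.2 ⟨hV.contMDiffAt, ?_⟩
  have h := hc.smul hV.contMDiffAt_coord
  convert h using 1
  ext1 p'
  simp [coord]

theorem contMDiffAt_form (hV : SmoothAlongAt k f V p) (hW : SmoothAlongAt k f W p) :
    ContMDiffAt (𝓡 k) 𝓘(ℝ, ℝ) ∞ (fun p ↦ g.form (f p) (V p) (W p)) p := by
  -- The scalar is viewed as a section of the trivial line bundle, so that smoothness of bundle maps
  -- applies.
  have h : ContMDiffAt (𝓡 k) ((𝓡 (n + 2)).prod 𝓘(ℝ, ℝ)) ∞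
      (fun p ↦ TotalSpace.mk' ℝ (E := Bundle.Trivial Mbar ℝ) (f p)
        (g.form (f p) (V p) (W p))) p := by
    apply ContMDiffAt.clm_bundle_apply₂ (F₁ := Model (n + 2)) (F₂ := Model (n + 2))
    · exact ContMDiffAt.comp p (g.smooth (f p)) hV.contMDiffAt
    · exact hV
    · exact hW
  simp only [contMDiffAt_totalSpace] at h
  exact h.2

end Along

/-! ### The metric in coordinates -/

theorem contDiffOn_inChart (q₀ : Mbar) :
    ContDiffOn ℝ ∞ (g.inChart q₀) (extChartAt (𝓡 (n + 2)) q₀).target := by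
  rw [contDiffOn_clm_apply]
  intro a
  rw [contDiffOn_clm_apply]
  intro b
  rw [← contMDiffOn_iff_contDiffOn]
  -- The metric coefficients are scalar products of fields with constant components, and such fields
  -- are smooth on the chart domain.
  have hs : ∀ (c : Model (n + 2)) (q : Mbar), q ∈ (chartAt (Model (n + 2)) q₀).source →
      SmoothAlongAt (n + 2) (fun q : Mbar ↦ q)
        (fun q ↦ (coordTriv (n := n) q₀).symmL ℝ q c) q := by
    intro c q hq
    have hq' := mem_baseSet_coordTriv.2 hq
    rw [SmoothAlongAt, (coordTriv (n := n) q₀).contMDiffAt_iff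
      ((Trivialization.mem_source _).2 hq')]
    refine ⟨contMDiffAt_id, (contMDiffAt_const (c := c)).congr_of_eventuallyEq ?_⟩
    filter_upwards [(coordTriv (n := n) q₀).open_baseSet.mem_nhds hq'] with x hx
    have := Trivialization.continuousLinearMapAt_symmL (R := ℝ) _ hx c
    rwa [Trivialization.continuousLinearMapAt_apply,
      Trivialization.coe_linearMapAt_of_mem _ hx] at this
  intro y hy
  have hq : (extChartAt (𝓡 (n + 2)) q₀).symm y ∈ (chartAt (Model (n + 2)) q₀).source := by
    rw [← extChartAt_source (𝓡 (n + 2))]; exact (extChartAt (𝓡 (n + 2)) q₀).map_target hy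
  exact (g.contMDiffAt_form (hs a _ hq) (hs b _ hq)).comp_contMDiffWithinAt y
    (contMDiffOn_extChartAt_symm q₀ y hy)

theorem hasFDerivAt_inChart (q₀ : Mbar) :
    HasFDerivAt (g.inChart q₀) (g.dInChart q₀) (extChartAt (𝓡 (n + 2)) q₀ q₀) :=
  (((g.contDiffOn_inChart q₀).contDiffAt (extChartAt_target_mem_nhds q₀)).differentiableAt
    (by simp)).hasFDerivAt

theorem inChart_symm (q₀ : Mbar) (y u v : Model (n + 2)) :
    g.inChart q₀ y u v = g.inChart q₀ y v u :=
  g.symm _ _ _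

theorem dInChart_symm (q₀ : Mbar) (w u v : Model (n + 2)) :
    g.dInChart q₀ w u v = g.dInChart q₀ w v u := by
  have h : ∀ a b, HasFDerivAt (fun y ↦ g.inChart q₀ y a b)
      (((ContinuousLinearMap.apply ℝ ℝ b) ∘L (ContinuousLinearMap.apply ℝ _ a)) ∘L g.dInChart q₀)
      (extChartAt (𝓡 (n + 2)) q₀ q₀) := fun a b ↦
    (ContinuousLinearMap.hasFDerivAt
      ((ContinuousLinearMap.apply ℝ ℝ b) ∘L (ContinuousLinearMap.apply ℝ _ a))).comp _
      (g.hasFDerivAt_inChart q₀)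
  have h1 := h u v
  simp_rw [g.inChart_symm q₀ _ u v] at h1
  exact congrArg (fun T : Model (n + 2) →L[ℝ] ℝ ↦ T w) (h1.unique (h v u))

theorem christoffel_symm (q₀ : Mbar) (u v : Model (n + 2)) :
    g.christoffel q₀ u v = g.christoffel q₀ v u := by
  have h : koszul (g.dInChart q₀) u v = koszul (g.dInChart q₀) v u := by
    ext w
    rw [koszul_apply, koszul_apply, g.dInChart_symm q₀ w u v]
    ring
  exact congrArg (g.inChart q₀ (extChartAt (𝓡 (n + 2)) q₀ q₀)).inverse h

theorem form_eq_inChart {q₀ q : Mbar} (hq : q ∈ (chartAt (Model (n + 2)) q₀).source)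
    (u v : TangentSpace (𝓡 (n + 2)) q) :
    g.form q u v = g.inChart q₀ (extChartAt (𝓡 (n + 2)) q₀ q)
      ((coordTriv (n := n) q₀).continuousLinearMapAt ℝ q u)
      ((coordTriv (n := n) q₀).continuousLinearMapAt ℝ q v) := by
  have h : (extChartAt (𝓡 (n + 2)) q₀).symm (extChartAt (𝓡 (n + 2)) q₀ q) = q :=
    (extChartAt (𝓡 (n + 2)) q₀).left_inv (by rwa [extChartAt_source])
  simp only [inChart]
  rw [h]
  have hs := fun w ↦ (coordTriv (n := n) q₀).symmL_continuousLinearMapAt (R := ℝ)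
    (mem_baseSet_coordTriv.2 hq) w
  change _ = g.form q ((coordTriv (n := n) q₀).symmL ℝ q
    ((coordTriv (n := n) q₀).continuousLinearMapAt ℝ q u)) ((coordTriv (n := n) q₀).symmL ℝ q
    ((coordTriv (n := n) q₀).continuousLinearMapAt ℝ q v))
  rw [hs, hs]

/-! ### Properties of the covariant derivative along a map -/

section CovDeriv

variable {k : ℕ} {L : Type*} [TopologicalSpace L] [ChartedSpace (Model k) L]
  {f : L → Mbar} {V W : (p : L) → TangentSpace (𝓡 (n + 2)) (f p)} {p : L}

/-- The differential of `f` at `p` in the chart at `f p`. -/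
def dcoord (f : L → Mbar) (p : L) : TangentSpace (𝓡 k) p →L[ℝ] Model (n + 2) :=
  (coordTriv (n := n) (f p)).continuousLinearMapAt ℝ (f p) ∘L mfderiv (𝓡 k) (𝓡 (n + 2)) f p

/-- The derivative at `p` of the components of `V` in the coordinate frame of the chart at
`f p`. -/
def mfderivCoord (f : L → Mbar) (V : (p : L) → TangentSpace (𝓡 (n + 2)) (f p)) (p : L) :
    TangentSpace (𝓡 k) p →L[ℝ] Model (n + 2) :=
  mfderiv (𝓡 k) 𝓘(ℝ, Model (n + 2)) (coord f V p) p

theorem continuousLinearMapAt_covDeriv (hf : ContinuousAt f p) (X : TangentSpace (𝓡 k) p) :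
    (coordTriv (n := n) (f p)).continuousLinearMapAt ℝ (f p) (g.covDeriv f V p X) =
      mfderivCoord f V p X +
        g.christoffel (f p) (dcoord f p X) (coord f V p p) := by
  rw [mfderivCoord, ← (coord_eventuallyEq (V := V) hf).mfderiv_eq]
  exact Trivialization.continuousLinearMapAt_symmL _
    (FiberBundle.mem_baseSet_trivializationAt' (f p)) _

theorem hasMFDerivAt_extChartAt_comp (hf : MDifferentiableAt (𝓡 k) (𝓡 (n + 2)) f p) :
    HasMFDerivAt (𝓡 k) 𝓘(ℝ, Model (n + 2)) (fun p' ↦ extChartAt (𝓡 (n + 2)) (f p) (f p')) p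
      (dcoord f p) := by
  have h := (mdifferentiableAt_extChartAt (I := 𝓡 (n + 2))
    (mem_chart_source (Model (n + 2)) (f p))).hasMFDerivAt.comp p hf.hasMFDerivAt
  rw [← TangentBundle.continuousLinearMapAt_trivializationAt (mem_chart_source _ (f p))] at h
  exact h

end CovDeriv
end LorentzMetric

namespace LorentzMetric

theorem contDiffAt_extChartAt_comp {n l : ℕ} {Mbar : Type*} [TopologicalSpace Mbar]
    [ChartedSpace (Model (n + 2)) Mbar] {F : Model l → Mbar} {u₀ : Model l}
    (hF : ContMDiffAt (𝓡 l) (𝓡 (n + 2)) ∞ F u₀) :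
    ContDiffAt ℝ ∞ (fun u ↦ extChartAt (𝓡 (n + 2)) (F u₀) (F u)) u₀ :=
  contMDiffAt_iff_contDiffAt.1 (contMDiffAt_extChartAt.comp u₀ hF)

variable {n : ℕ} {Mbar : Type*} [TopologicalSpace Mbar]
  [ChartedSpace (Model (n + 2)) Mbar] [IsManifold (𝓡 (n + 2)) ∞ Mbar]
  (g : LorentzMetric n Mbar)

section CovDeriv

variable {k : ℕ} {L : Type*} [TopologicalSpace L] [ChartedSpace (Model k) L]
  {f : L → Mbar} {V W : (p : L) → TangentSpace (𝓡 (n + 2)) (f p)} {p : L}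

/-- The differential at `p` of a real function. -/
def differential (h : L → ℝ) (p : L) : TangentSpace (𝓡 k) p →L[ℝ] ℝ :=
  mfderiv (𝓡 k) 𝓘(ℝ, ℝ) h p

/-- The Levi-Civita connection is compatible with the metric. -/
theorem differential_form (hV : SmoothAlongAt k f V p) (hW : SmoothAlongAt k f W p)
    (X : TangentSpace (𝓡 k) p) :
    differential (fun p ↦ g.form (f p) (V p) (W p)) p X =
      g.form (f p) (g.covDeriv f V p X) (W p) + g.form (f p) (V p) (g.covDeriv f W p X) := by
  have hf := hV.contMDiffAt
  have hfc := hf.continuousAt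
  -- Near `p` the scalar product is `(y, v, w) ↦ G(y)(v, w)` composed with the coordinates of `f`,
  -- `V` and `W`; the product rule then gives three terms.
  have hev : (fun p' ↦ g.form (f p') (V p') (W p')) =ᶠ[𝓝 p] fun p' ↦
      g.inChart (f p) (extChartAt (𝓡 (n + 2)) (f p) (f p')) (coord f V p p') (coord f W p p') := by
    filter_upwards [hfc.eventually_mem (chart_source_mem_nhds (Model (n + 2)) _)] with p' hp'
    exact g.form_eq_inChart hp' _ _
  have hc := hasMFDerivAt_extChartAt_comp (hf.mdifferentiableAt (by simp))
  have hv : HasMFDerivAt (𝓡 k) 𝓘(ℝ, Model (n + 2)) (coord f V p) p (mfderivCoord f V p) :=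
    hV.mdifferentiableAt_coord.hasMFDerivAt
  have hw : HasMFDerivAt (𝓡 k) 𝓘(ℝ, Model (n + 2)) (coord f W p) p (mfderivCoord f W p) :=
    hW.mdifferentiableAt_coord.hasMFDerivAt
  have hG := g.hasFDerivAt_inChart (f p)
  have hΦ := ((hG.comp (extChartAt (𝓡 (n + 2)) (f p) (f p), coord f V p p, coord f W p p)
      (hasFDerivAt_fst (𝕜 := ℝ))).clm_apply
        ((hasFDerivAt_fst (𝕜 := ℝ)).comp _ (hasFDerivAt_snd (𝕜 := ℝ)))).clm_apply
        ((hasFDerivAt_snd (𝕜 := ℝ)).comp _ (hasFDerivAt_snd (𝕜 := ℝ)))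
  have hprod : HasMFDerivAt (𝓡 k) 𝓘(ℝ, Model (n + 2) × Model (n + 2) × Model (n + 2))
      (fun p' ↦ (extChartAt (𝓡 (n + 2)) (f p) (f p'), coord f V p p', coord f W p p')) p
      ((dcoord f p).prod ((mfderivCoord f V p).prod (mfderivCoord f W p))) :=
    ⟨hc.1.prodMk (hv.1.prodMk hw.1), hc.2.prodMk (hv.2.prodMk hw.2)⟩
  have h' := HasMFDerivAt.congr_of_eventuallyEq (HasMFDerivAt.comp p hΦ.hasMFDerivAt hprod) hev
  have hR := congrArg₂ (· + ·)
    (g.form_eq_inChart (mem_chart_source _ (f p)) (g.covDeriv f V p X) (W p))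
    (g.form_eq_inChart (mem_chart_source _ (f p)) (V p) (g.covDeriv f W p X))
  simp only [g.continuousLinearMapAt_covDeriv hfc] at hR
  refine Eq.trans ?_ hR.symm
  rw [differential, h'.mfderiv]
  change g.inChart (f p) (extChartAt (𝓡 (n + 2)) (f p) (f p)) (coord f V p p)
      (mfderivCoord f W p X) +
    (g.inChart (f p) (extChartAt (𝓡 (n + 2)) (f p) (f p)) (mfderivCoord f V p X) (coord f W p p) +
      g.dInChart (f p) (dcoord f p X) (coord f V p p) (coord f W p p)) =
    g.inChart (f p) _ (_ + _) (coord f W p p) + g.inChart (f p) _ (coord f V p p) (_ + _)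
  -- In `g(Γ(X, V), W) + g(V, Γ(X, W))` the Koszul terms not differentiating along `X` cancel,
  -- leaving `∂_X g(V, W)`.
  rw [map_add, map_add, add_apply,
    g.inChart_symm _ _ (coord f V p p) (g.christoffel _ _ _), inChart_christoffel,
    inChart_christoffel, g.dInChart_symm _ _ (coord f W p p) (coord f V p p)]
  ring

/-- The chain rule for the covariant derivative. -/
theorem covDeriv_comp {l : ℕ} {L' : Type*} [TopologicalSpace L'] [ChartedSpace (Model l) L']
    {j : L' → L} {u : L'} (hj : MDifferentiableAt (𝓡 l) (𝓡 k) j u)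
    (hV : SmoothAlongAt k f V (j u)) (X : TangentSpace (𝓡 l) u) :
    g.covDeriv (fun u ↦ f (j u)) (fun u ↦ V (j u)) u X =
      g.covDeriv f V (j u) (mfderiv (𝓡 l) (𝓡 k) j u X) := by
  have hf : MDifferentiableAt (𝓡 k) (𝓡 (n + 2)) f (j u) :=
    hV.contMDiffAt.mdifferentiableAt (by simp)
  refine Function.LeftInverse.injective
    ((coordTriv (n := n) (f (j u))).symmL_continuousLinearMapAt (R := ℝ)
      (FiberBundle.mem_baseSet_trivializationAt' (f (j u)))) ?_
  have h1 := g.continuousLinearMapAt_covDeriv (f := fun u ↦ f (j u)) (V := fun u ↦ V (j u))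
    (hf.continuousAt.comp hj.continuousAt) X
  refine h1.trans ?_
  rw [g.continuousLinearMapAt_covDeriv hf.continuousAt]
  have h2 : dcoord (n := n) (fun u ↦ f (j u)) u X =
      dcoord (n := n) f (j u) (mfderiv (𝓡 l) (𝓡 k) j u X) := by
    have := (hf.hasMFDerivAt.comp u hj.hasMFDerivAt).mfderiv
    exact congrArg (fun T : TangentSpace (𝓡 l) u →L[ℝ] TangentSpace (𝓡 (n + 2)) (f (j u)) ↦
      (coordTriv (n := n) (f (j u))).continuousLinearMapAt ℝ (f (j u)) (T X)) this
  have h3 : mfderivCoord (fun u ↦ f (j u)) (fun u ↦ V (j u)) u X =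
      mfderivCoord f V (j u) (mfderiv (𝓡 l) (𝓡 k) j u X) := by
    have := (hV.mdifferentiableAt_coord.hasMFDerivAt.comp u hj.hasMFDerivAt).mfderiv
    exact congrArg (fun T : TangentSpace (𝓡 l) u →L[ℝ] Model (n + 2) ↦ T X) this
  rw [h2, h3]
  rfl

end CovDeriv

/-! ### Coordinate fields along a map and vanishing torsion -/

section Torsion

variable {l : ℕ} {F : Model l → Mbar} {u₀ : Model l}

/-- The vector field `∂_a F` along the map `F`. -/
def coordField (F : Model l → Mbar) (a u : Model l) : TangentSpace (𝓡 (n + 2)) (F u) :=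
  mfderiv (𝓡 l) (𝓡 (n + 2)) F u (show TangentSpace (𝓡 l) u from a)

/-- The tangent bundle trivialization is the differential of the chart. Equality near `u₀`, not just
at it, is what allows a second differentiation. -/
theorem coord_coordField_eventuallyEq (hF : ContMDiffAt (𝓡 l) (𝓡 (n + 2)) ∞ F u₀) (a : Model l) :
    coord F (coordField F a) u₀ =ᶠ[𝓝 u₀]
      fun u ↦ fderiv ℝ (fun u' ↦ extChartAt (𝓡 (n + 2)) (F u₀) (F u')) u a := by
  -- Only finite regularity at a point spreads to a neighbourhood, so the order drops to one.
  have hF1 := (contMDiffAt_iff_contMDiffAt_nhds (n := 1) (by simp)).1 (hF.of_le (by simp))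
  filter_upwards [hF.continuousAt.eventually_mem (chart_source_mem_nhds (Model (n + 2)) _),
    hF1] with u hu hFu
  have h := ((mdifferentiableAt_extChartAt (I := 𝓡 (n + 2)) hu).hasMFDerivAt.comp u
    (hFu.mdifferentiableAt (by simp)).hasMFDerivAt).mfderiv
  rw [mfderiv_eq_fderiv, ← TangentBundle.continuousLinearMapAt_trivializationAt hu] at h
  exact congrArg (fun T : Model l →L[ℝ] Model (n + 2) ↦ T a) h.symm

theorem smoothAlongAt_coordField (hF : ContMDiffAt (𝓡 l) (𝓡 (n + 2)) ∞ F u₀) (a : Model l) :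
    SmoothAlongAt l F (coordField (n := n) F a) u₀ := by
  refine smoothAlongAt_iff.2 ⟨hF, ?_⟩
  refine ContMDiffAt.congr_of_eventuallyEq ?_ (coord_coordField_eventuallyEq hF a)
  refine contMDiffAt_iff_contDiffAt.2 ?_
  exact ((contDiffAt_extChartAt_comp hF).fderiv_right (m := ∞) (by simp)).clm_apply
    contDiffAt_const

/-- The Levi-Civita connection is torsion-free: along a map from `ℝ^l`, the covariant derivatives
of the coordinate fields commute. -/
theorem covDeriv_coordField_comm (hF : ContMDiffAt (𝓡 l) (𝓡 (n + 2)) ∞ F u₀) (a b : Model l) :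
    g.covDeriv F (coordField F a) u₀ b =
      g.covDeriv F (coordField F b) u₀ a := by
  refine Function.LeftInverse.injective
    ((coordTriv (n := n) (F u₀)).symmL_continuousLinearMapAt (R := ℝ)
      (FiberBundle.mem_baseSet_trivializationAt' (F u₀))) ?_
  refine (g.continuousLinearMapAt_covDeriv hF.continuousAt _).trans
    (Eq.trans ?_ (g.continuousLinearMapAt_covDeriv hF.continuousAt _).symm)
  have hc := contDiffAt_extChartAt_comp hF
  have hc' := (hc.fderiv_right (m := ∞) (by simp)).differentiableAt (by simp)
  have h1 : ∀ a b : Model l,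
      mfderivCoord F (coordField F a) u₀ b =
        fderiv ℝ (fderiv ℝ (fun u ↦ extChartAt (𝓡 (n + 2)) (F u₀) (F u))) u₀ b a := by
    intro a b
    have h2 : fderiv ℝ
        (fun u ↦ fderiv ℝ (fun u' ↦ extChartAt (𝓡 (n + 2)) (F u₀) (F u')) u a) u₀ b =
        fderiv ℝ (fderiv ℝ (fun u ↦ extChartAt (𝓡 (n + 2)) (F u₀) (F u))) u₀ b a := by
      rw [(hc'.hasFDerivAt.clm_apply (hasFDerivAt_const a u₀)).fderiv]
      simp
    rw [mfderivCoord, (coord_coordField_eventuallyEq hF a).mfderiv_eq, mfderiv_eq_fderiv]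
    exact h2
  have hm : minSmoothness ℝ 2 ≤ ∞ := by
    rw [minSmoothness_of_isRCLikeNormedField]
    exact WithTop.coe_le_coe.2 (le_top : (2 : ℕ∞) ≤ ⊤)
  -- Symmetry of second derivatives and of the Christoffel symbols.
  rw [h1, h1, hc.isSymmSndFDerivAt hm b a, g.christoffel_symm]
  rfl

end Torsion

end LorentzMetric

/-! ### Null frames, the splitting along the screen, and the shape operator -/

namespace NullHypersurface

open LorentzMetric

variable {n : ℕ} {Mbar : Type*} [TopologicalSpace Mbar]
  [ChartedSpace (Model (n + 2)) Mbar] [IsManifold (𝓡 (n + 2)) ∞ Mbar]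
  {g : LorentzMetric n Mbar} {M : Type*} [TopologicalSpace M]
  [ChartedSpace (Model (n + 1)) M] [IsManifold (𝓡 (n + 1)) ∞ M]
  (H : NullHypersurface g M)

instance finiteDimensional_tangentSpace (k : ℕ) {L : Type*} [TopologicalSpace L]
    [ChartedSpace (Model k) L] (p : L) : FiniteDimensional ℝ (TangentSpace (𝓡 k) p) :=
  inferInstanceAs (FiniteDimensional ℝ (Model k))

theorem finrank_tangentSpace (k : ℕ) {L : Type*} [TopologicalSpace L]
    [ChartedSpace (Model k) L] (p : L) : Module.finrank ℝ (TangentSpace (𝓡 k) p) = k :=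
  (finrank_euclideanSpace_fin (𝕜 := ℝ) (n := k) :)

theorem finrank_screen (p : M) : Module.finrank ℝ (H.screen p) = n := by
  obtain ⟨U, -, hp, e, -, he⟩ := H.smooth_screen p
  obtain ⟨hli, hspan⟩ := he p hp
  rw [← hspan, finrank_span_eq_card hli, Fintype.card_fin]

theorem finrank_radical (p : M) : Module.finrank ℝ (g.radical H.imm p) = 1 := by
  have h := Submodule.finrank_add_eq_of_isCompl (H.isCompl_screen_radical p)
  rw [H.finrank_screen, finrank_tangentSpace] at h
  omega

theorem form_perp_push (p : M) (Y : TangentSpace (𝓡 (n + 2)) (H.imm p)) (s : H.screen p) :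
    g.form (H.imm p) (H.perp p Y) (H.push p s) = 0 := by
  rw [perp, map_sub, sub_apply, screenProj_spec, sub_self]

theorem perp_add_push (p : M) (Y : TangentSpace (𝓡 (n + 2)) (H.imm p)) :
    H.perp p Y + H.push p (H.screenProj p Y) = Y :=
  sub_add_cancel _ _

theorem form_perp_self (p : M) (Y : TangentSpace (𝓡 (n + 2)) (H.imm p)) :
    g.form (H.imm p) (H.perp p Y) Y = g.form (H.imm p) (H.perp p Y) (H.perp p Y) := by
  conv_lhs => enter [2]; rw [← H.perp_add_push p Y]
  rw [map_add, form_perp_push, add_zero]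

namespace IsNullFrame

variable {H} {ξ : (p : M) → TangentSpace (𝓡 (n + 1)) p}
  {N : (p : M) → TangentSpace (𝓡 (n + 2)) (H.imm p)}

theorem form_push_xi (hF : H.IsNullFrame ξ N) (p : M) (X : TangentSpace (𝓡 (n + 1)) p) :
    g.form (H.imm p) (H.push p X) (H.push p (ξ p)) = 0 :=
  (g.symm _ _ _).trans (hF.xi_mem p X)

theorem exists_smul_xi (hF : H.IsNullFrame ξ N) {p : M} {X : TangentSpace (𝓡 (n + 1)) p}
    (hX : X ∈ g.radical H.imm p) : ∃ c : ℝ, c • ξ p = X := by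
  have hne : (⟨ξ p, hF.xi_mem p⟩ : g.radical H.imm p) ≠ 0 := by
    intro h
    have h0 : ξ p = 0 := congrArg Subtype.val h
    have h1 := hF.form_xi_N p
    rw [h0, map_zero, map_zero, zero_apply] at h1
    exact zero_ne_one h1
  obtain ⟨c, hc⟩ := (finrank_eq_one_iff_of_nonzero' _ hne).1 (H.finrank_radical p) ⟨X, hX⟩
  exact ⟨c, congrArg Subtype.val hc⟩

/-- Dimensions match, so injectivity of `(X, t) ↦ X + tN` suffices: pairing with `ξ` kills `t`, the
remaining `X` is radical, hence a multiple of `ξ`, and pairing with `N` kills it. -/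
theorem exists_push_add_smul (hF : H.IsNullFrame ξ N) (p : M)
    (Y : TangentSpace (𝓡 (n + 2)) (H.imm p)) :
    ∃ (X : TangentSpace (𝓡 (n + 1)) p) (t : ℝ), H.push p X + t • N p = Y := by
  let Φ : TangentSpace (𝓡 (n + 1)) p × ℝ →ₗ[ℝ] TangentSpace (𝓡 (n + 2)) (H.imm p) :=
    (H.push p).toLinearMap.coprod (LinearMap.toSpanSingleton ℝ _ (N p))
  have hΦ : Function.Injective Φ := by
    rw [injective_iff_map_eq_zero]
    rintro ⟨X, t⟩ h
    have h' : H.push p X + t • N p = 0 := h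
    have ht : t = 0 := by
      have h1 := congrArg (fun v ↦ g.form (H.imm p) v (H.push p (ξ p))) h'
      simpa [hF.form_push_xi, g.symm _ (N p), hF.form_xi_N] using h1
    rw [ht, zero_smul, add_zero] at h'
    have hX : X ∈ g.radical H.imm p := by
      intro w
      change g.form (H.imm p) (H.push p X) (H.push p w) = 0
      rw [h', map_zero, zero_apply]
    obtain ⟨c, rfl⟩ := hF.exists_smul_xi hX
    have h1 := congrArg (fun v ↦ g.form (H.imm p) v (N p)) h'
    have hc : c = 0 := by simpa [hF.form_xi_N] using h1
    simp [hc, ht]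
  have hs := (LinearMap.injective_iff_surjective_of_finrank_eq_finrank (f := Φ) (by
    rw [Module.finrank_prod, finrank_tangentSpace, finrank_tangentSpace,
      Module.finrank_self])).1 hΦ
  obtain ⟨⟨X, t⟩, h⟩ := hs Y
  exact ⟨X, t, h⟩

/-- The two sides have the same scalar products with the screen, `ξ` and `N`, which together span
the ambient tangent space. -/
theorem perp_eq (hF : H.IsNullFrame ξ N) (p : M) (Y : TangentSpace (𝓡 (n + 2)) (H.imm p)) :
    H.perp p Y = g.form (H.imm p) Y (N p) • H.push p (ξ p) +
      g.form (H.imm p) Y (H.push p (ξ p)) • N p := by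
  have hξN := hF.form_xi_N p
  have hNξ : g.form (H.imm p) (N p) (H.push p (ξ p)) = 1 := (g.symm _ _ _).trans hξN
  have hNs := hF.form_N_screen p
  rw [← sub_eq_zero]
  apply g.form_nondegenerate
  have hperp : ∀ v, g.form (H.imm p) (H.perp p Y) v =
      g.form (H.imm p) Y v - g.form (H.imm p) (H.push p (H.screenProj p Y)) v := by
    intro v
    rw [perp, map_sub, sub_apply]
  have hN : g.form (H.imm p) (H.push p (H.screenProj p Y)) (N p) = 0 :=
    (g.symm _ _ _).trans (hNs _ (H.screenProj p Y).2)
  have hξs : ∀ w, g.form (H.imm p) (H.push p (ξ p)) (H.push p w) = 0 := hF.xi_mem p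
  intro v
  obtain ⟨X, t, rfl⟩ := hF.exists_push_add_smul p v
  have hX : X ∈ H.screen p ⊔ g.radical H.imm p := by
    rw [(H.isCompl_screen_radical p).sup_eq_top]; trivial
  obtain ⟨s, hs, r, hr, rfl⟩ := Submodule.mem_sup.1 hX
  obtain ⟨c, rfl⟩ := hF.exists_smul_xi hr
  have h1 : g.form (H.imm p) (H.perp p Y) (H.push p s) = 0 := H.form_perp_push p Y ⟨s, hs⟩
  simp only [map_sub, map_add, map_smul, sub_apply, add_apply, smul_apply, smul_eq_mul, h1]
  rw [hperp, hperp, hN, hF.form_push_xi, hξs, hξs, hNs s hs, hξN, hNξ, hF.form_N_N]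
  ring

theorem form_perp_perp (hF : H.IsNullFrame ξ N) (p : M)
    (Y : TangentSpace (𝓡 (n + 2)) (H.imm p)) :
    g.form (H.imm p) (H.perp p Y) (H.perp p Y) =
      2 * (g.form (H.imm p) Y (H.push p (ξ p)) * g.form (H.imm p) Y (N p)) := by
  rw [hF.perp_eq]
  have hNξ : g.form (H.imm p) (N p) (H.push p (ξ p)) = 1 :=
    (g.symm _ _ _).trans (hF.form_xi_N p)
  simp only [map_add, map_smul, add_apply, smul_apply, smul_eq_mul, hF.form_push_xi, hNξ,
    hF.form_N_N, hF.form_xi_N]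
  ring

theorem smoothAlongAt_push (hF : H.IsNullFrame ξ N) (p : M) :
    SmoothAlongAt (n + 1) H.imm (fun p ↦ H.push p (ξ p)) p :=
  ((H.isImmersion.contMDiff.contMDiff_tangentMap (m := ∞) (by simp)).comp hF.smooth_xi) p

/-- The screen projection is defined pointwise by duality; smoothness is read off from the null
frame formula instead. -/
theorem smoothAlongAt_perp (hF : H.IsNullFrame ξ N)
    {V : (p : M) → TangentSpace (𝓡 (n + 2)) (H.imm p)} {p : M}
    (hV : SmoothAlongAt (n + 1) H.imm V p) :
    SmoothAlongAt (n + 1) H.imm (fun p ↦ H.perp p (V p)) p := by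
  have hξ := hF.smoothAlongAt_push p
  have hN : SmoothAlongAt (n + 1) H.imm N p := hF.smooth_N p
  simp_rw [hF.perp_eq]
  exact (hξ.smul (g.contMDiffAt_form hV hN)).add (hN.smul (g.contMDiffAt_form hV hξ))

/-- The product of the two angles that a vector makes with a null frame depends only on its
component in `S(TM)^⊥`. -/
theorem two_mul_angle_mul_angle (hF : H.IsNullFrame ξ N) (p : M)
    (Y : TangentSpace (𝓡 (n + 2)) (H.imm p)) :
    2 * (g.angle Y (H.push p (ξ p)) * g.angle Y (N p)) =
      g.form (H.imm p) (H.perp p Y) (H.perp p Y) / |g.form (H.imm p) Y Y| := by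
  rw [hF.form_perp_perp, angle, angle, length, div_mul_div_comm,
    Real.mul_self_sqrt (abs_nonneg _), ← mul_div_assoc]

end IsNullFrame

/-- For an integrable screen distribution, `g(∇̄_X V, Y)` is symmetric in `X` and `Y`; so the
shape operator `A_V` is self-adjoint. -/
theorem form_covDeriv_comm (hint : H.IsScreenIntegrable)
    {V : (p : M) → TangentSpace (𝓡 (n + 2)) (H.imm p)} {p : M}
    (hV : SmoothAlongAt (n + 1) H.imm V p)
    (hperp : ∀ p, ∀ s : H.screen p, g.form (H.imm p) (V p) (H.push p s) = 0)
    (X Y : H.screen p) :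
    g.form (H.imm p) (g.covDeriv (k := n + 1) H.imm V p X) (H.push p Y) =
      g.form (H.imm p) (g.covDeriv (k := n + 1) H.imm V p Y) (H.push p X) := by
  obtain ⟨U, u₀, j, hU, hu₀, rfl, hj, hscreen⟩ := hint p
  have hjs : ∀ u ∈ U, ContMDiffAt (𝓡 n) (𝓡 (n + 1)) ∞ j u := fun u hu ↦
    hj.contMDiffAt (hU.mem_nhds hu)
  have hjd : ∀ u ∈ U, MDifferentiableAt (𝓡 n) (𝓡 (n + 1)) j u := fun u hu ↦
    (hjs u hu).mdifferentiableAt (by simp)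
  let F : Model n → Mbar := fun u ↦ H.imm (j u)
  have hF : ContMDiffAt (𝓡 n) (𝓡 (n + 2)) ∞ F u₀ :=
    (H.isImmersion.contMDiff (j u₀)).comp u₀ (hjs u₀ hu₀)
  have hdF : ∀ u ∈ U, ∀ a : Model n,
      coordField F a u = H.push (j u) (mfderiv (𝓡 n) (𝓡 (n + 1)) j u a) := by
    intro u hu a
    have h := (((H.isImmersion.contMDiff (j u)).mdifferentiableAt
      (by simp)).hasMFDerivAt.comp u (hjd u hu).hasMFDerivAt).mfderiv
    exact congrArg (fun T : Model n →L[ℝ] TangentSpace (𝓡 (n + 2)) (F u) ↦ T a) h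
  have hVj : SmoothAlongAt n F (fun u ↦ V (j u)) u₀ := ContMDiffAt.comp u₀ hV (hjs u₀ hu₀)
  -- On the leaf through the point, `V` is orthogonal to every coordinate field; differentiating
  -- this moves the derivative from `V` to the field.
  have key : ∀ a b : Model n,
      g.form (F u₀) (g.covDeriv (k := n + 1) H.imm V (j u₀) (mfderiv (𝓡 n) (𝓡 (n + 1)) j u₀ b))
        (coordField F a u₀) =
      -g.form (F u₀) (V (j u₀)) (g.covDeriv F (coordField F a) u₀ b) := by
    intro a b
    have h := g.differential_form hVj (smoothAlongAt_coordField hF a) b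
    have h0 : (fun u ↦ g.form (F u) (V (j u)) (coordField F a u)) =ᶠ[𝓝 u₀] fun _ ↦ (0 : ℝ) := by
      filter_upwards [hU.mem_nhds hu₀] with u hu
      have hm : mfderiv (𝓡 n) (𝓡 (n + 1)) j u a ∈ (H.screen (j u) : Set _) :=
        (hscreen u hu).2 ▸ Set.mem_range_self _
      rw [hdF u hu]
      exact hperp (j u) ⟨_, hm⟩
    rw [differential, h0.mfderiv_eq, mfderiv_const] at h
    have h1 := g.covDeriv_comp (hjd u₀ hu₀) hV b
    rw [← h1]
    exact eq_neg_of_add_eq_zero_left h.symm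
  have hex : ∀ s : H.screen (j u₀), ∃ a : Model n,
      mfderiv (𝓡 n) (𝓡 (n + 1)) j u₀ a = (s : TangentSpace (𝓡 (n + 1)) (j u₀)) := by
    intro s
    have : (s : TangentSpace (𝓡 (n + 1)) (j u₀)) ∈
        Set.range (mfderiv (𝓡 n) (𝓡 (n + 1)) j u₀) := (hscreen u₀ hu₀).2 ▸ s.2
    exact this
  obtain ⟨a, ha⟩ := hex X
  obtain ⟨b, hb⟩ := hex Y
  rw [← ha, ← hb, ← hdF u₀ hu₀, ← hdF u₀ hu₀]
  refine (key b a).trans (Eq.trans ?_ (key a b).symm)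
  -- Symmetry in the two directions is exactly vanishing torsion along the leaf.
  exact congrArg (fun v ↦ -g.form (F u₀) (V (j u₀)) v) (g.covDeriv_coordField_comm hF b a)

theorem screen_ext {p : M} {X Y : H.screen p}
    (h : ∀ s : H.screen p, g.form (H.imm p) (H.push p X) (H.push p s) =
      g.form (H.imm p) (H.push p Y) (H.push p s)) : X = Y := by
  rw [← sub_eq_zero]
  refine (H.screenForm_nondegenerate p).1 _ fun s ↦ ?_
  rw [map_sub, LinearMap.sub_apply]
  exact sub_eq_zero.2 (h s)

theorem form_push_shapeOperator (V : (p : M) → TangentSpace (𝓡 (n + 2)) (H.imm p)) (p : M)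
    (X s : H.screen p) :
    g.form (H.imm p) (H.push p (H.shapeOperator V p X)) (H.push p s) =
      -g.form (H.imm p) (g.covDeriv (k := n + 1) H.imm V p X) (H.push p s) := by
  have h := H.screenProj_spec p (g.covDeriv (k := n + 1) H.imm V p X) s
  rw [← h]
  change g.form (H.imm p)
    (H.push p (-(H.screenProj p (g.covDeriv (k := n + 1) H.imm V p X)) : H.screen p)) _ = _
  rw [Submodule.coe_neg, map_neg, map_neg, neg_apply]

/-! ### Closed conformal fields restricted to the hypersurface -/

section ClosedConformal

variable {Z : (q : Mbar) → TangentSpace (𝓡 (n + 2)) q} {φ : Mbar → ℝ}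

theorem smoothAlongAt_of_isClosedConformal (hZ : g.IsClosedConformal Z φ) (p : M) :
    SmoothAlongAt (n + 1) H.imm (fun p ↦ Z (H.imm p)) p :=
  ContMDiffAt.comp p (hZ.smooth_field (H.imm p)) (H.isImmersion.contMDiff p)

/-- The hypothesis concerns the derivative along the identity of `Mbar`; the chain rule transports
it to the immersion. -/
theorem covDeriv_of_isClosedConformal (hZ : g.IsClosedConformal Z φ) (p : M)
    (X : TangentSpace (𝓡 (n + 1)) p) :
    g.covDeriv (k := n + 1) H.imm (fun p ↦ Z (H.imm p)) p X = φ (H.imm p) • H.push p X := by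
  have h := g.covDeriv_comp (f := fun q : Mbar ↦ q) (V := Z) (j := H.imm) (u := p)
    ((H.isImmersion.contMDiff p).mdifferentiableAt (by simp)) (hZ.smooth_field (H.imm p)) X
  exact h.trans (hZ.covDeriv_eq _ _)

/-- The principal curvature of a closed conformal vector field along a null hypersurface of
constant angle: the squared length of `Z^⊥` is a constant multiple `c` of `|g(Z, Z)|`. -/
theorem shapeOperator_perp_of_isClosedConformal (hint : H.IsScreenIntegrable)
    (hZ : g.IsClosedConformal Z φ) {ξ : (p : M) → TangentSpace (𝓡 (n + 1)) p}
    {N : (p : M) → TangentSpace (𝓡 (n + 2)) (H.imm p)} (hF : H.IsNullFrame ξ N)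
    (hne : ∀ p, g.form (H.imm p) (Z (H.imm p)) (Z (H.imm p)) ≠ 0) {c : ℝ}
    (hc : ∀ p, g.form (H.imm p) (H.perp p (Z (H.imm p))) (H.perp p (Z (H.imm p))) =
      c * |g.form (H.imm p) (Z (H.imm p)) (Z (H.imm p))|) (p : M) :
    H.shapeOperator (fun p' ↦ H.perp p' (Z (H.imm p'))) p (H.screenProj p (Z (H.imm p))) =
      (-(c * Real.sign (g.form (H.imm p) (Z (H.imm p)) (Z (H.imm p))) * φ (H.imm p))) •
        H.screenProj p (Z (H.imm p)) := by
  set ε := Real.sign (g.form (H.imm p) (Z (H.imm p)) (Z (H.imm p))) with hε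
  have hZs := H.smoothAlongAt_of_isClosedConformal hZ p
  have hVs := hF.smoothAlongAt_perp hZs
  refine H.screen_ext fun Y ↦ ?_
  rw [form_push_shapeOperator, H.form_covDeriv_comm hint hVs (fun p s ↦ H.form_perp_push p _ s)]
  have hE := g.contMDiffAt_form hZs hZs
  -- `M` need not be connected, so the sign is only frozen near `p`; that is enough for derivatives
  -- at `p`.
  have habs : ∀ᶠ p' in 𝓝 p, |g.form (H.imm p') (Z (H.imm p')) (Z (H.imm p'))| =
      ε * g.form (H.imm p') (Z (H.imm p')) (Z (H.imm p')) := by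
    rcases lt_or_gt_of_ne (hne p) with h | h
    · filter_upwards [hE.continuousAt.eventually_lt_const h] with p' hp'
      rw [abs_of_neg hp', hε, Real.sign_of_neg h, neg_one_mul]
    · filter_upwards [hE.continuousAt.eventually_const_lt h] with p' hp'
      rw [abs_of_pos hp', hε, Real.sign_of_pos h, one_mul]
  have hP : (fun p ↦ g.form (H.imm p) (H.perp p (Z (H.imm p))) (H.perp p (Z (H.imm p)))) =ᶠ[𝓝 p]
      fun p ↦ (c * ε) * g.form (H.imm p) (Z (H.imm p)) (Z (H.imm p)) := by
    filter_upwards [habs] with p' hp'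
    rw [hc, hp', mul_assoc]
  have d1 := g.differential_form hZs hZs (Y : TangentSpace (𝓡 (n + 1)) p)
  have d2 := g.differential_form hVs hVs (Y : TangentSpace (𝓡 (n + 1)) p)
  have d3 := g.differential_form hVs hZs (Y : TangentSpace (𝓡 (n + 1)) p)
  have d4 : differential (fun p ↦ g.form (H.imm p) (H.perp p (Z (H.imm p)))
      (H.perp p (Z (H.imm p)))) p (Y : TangentSpace (𝓡 (n + 1)) p) =
      (c * ε) * differential (fun p ↦ g.form (H.imm p) (Z (H.imm p)) (Z (H.imm p))) p
        (Y : TangentSpace (𝓡 (n + 1)) p) := by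
    rw [differential, hP.mfderiv_eq]
    have := ((hE.mdifferentiableAt (by simp)).hasMFDerivAt.const_smul (c * ε)).mfderiv
    exact congrArg (fun T : TangentSpace (𝓡 (n + 1)) p →L[ℝ] ℝ ↦ T Y) this
  -- Now `d2` and `d3` are two derivatives of the same function, written as `g(Z^⊥, Z^⊥)` and as
  -- `g(Z^⊥, Z)`.
  simp only [form_perp_self] at d3
  rw [d4, d1] at d2
  rw [d4, d1] at d3
  simp only [H.covDeriv_of_isClosedConformal hZ, map_smul, smul_apply, smul_eq_mul,
    H.form_perp_push] at d2 d3
  have hsub := congrArg (fun v ↦ g.form (H.imm p)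
    (g.covDeriv (k := n + 1) H.imm (fun p ↦ H.perp p (Z (H.imm p))) p Y) v)
    (H.perp_add_push p (Z (H.imm p)))
  simp only [map_add] at hsub
  have hsymm := g.symm (H.imm p) (H.perp p (Z (H.imm p)))
    (g.covDeriv (k := n + 1) H.imm (fun p ↦ H.perp p (Z (H.imm p))) p Y)
  have hYZ := g.symm (H.imm p) (Z (H.imm p)) (H.push p Y)
  rw [Submodule.coe_smul, map_smul, map_smul, smul_apply, smul_eq_mul, screenProj_spec, hYZ]
  rw [hsymm] at d2
  rw [hYZ] at d2 d3
  -- Subtract half of `d2` from `d3`, using `hsub` to split `Z` into `Z^⊥` and `Z^*`.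
  linarith

end ClosedConformal

end NullHypersurface

end

theorem mainTheorem1 {n : ℕ} {Mbar : Type*} [TopologicalSpace Mbar]
    [ChartedSpace (Model (n + 2)) Mbar] [IsManifold (𝓡 (n + 2)) ∞ Mbar]
    (g : LorentzMetric n Mbar) {M : Type*} [TopologicalSpace M]
    [ChartedSpace (Model (n + 1)) M] [IsManifold (𝓡 (n + 1)) ∞ M]
    (H : NullHypersurface g M) (hint : H.IsScreenIntegrable)
    (Z : (q : Mbar) → TangentSpace (𝓡 (n + 2)) q) (φ : Mbar → ℝ)
    (hZ : g.IsClosedConformal Z φ)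
    (hangle : H.HasConstantAngle (fun p ↦ Z (H.imm p))) :
    H.IsCanonicalPrincipalDirection (fun p ↦ Z (H.imm p)) ∧
    ∀ ξ N, H.IsNullFrame ξ N → ∀ p : M,
      H.shapeOperator (fun p' ↦ H.perp p' (Z (H.imm p'))) p (H.screenProj p (Z (H.imm p))) =
        (-(2 * Real.sign (g.form (H.imm p) (Z (H.imm p)) (Z (H.imm p))) *
            g.angle (Z (H.imm p)) (H.push p (ξ p)) * g.angle (Z (H.imm p)) (N p) *
            φ (H.imm p))) •
          H.screenProj p (Z (H.imm p)) := by
  obtain ⟨hne, ξ₀, N₀, hF, a, b, hab⟩ := hangle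
  have hc : ∀ p, g.form (H.imm p) (H.perp p (Z (H.imm p))) (H.perp p (Z (H.imm p))) =
      (2 * (a * b)) * |g.form (H.imm p) (Z (H.imm p)) (Z (H.imm p))| := by
    intro p
    have h := hF.two_mul_angle_mul_angle p (Z (H.imm p))
    rw [(hab p).1, (hab p).2] at h
    rw [h, div_mul_cancel₀ _ (abs_ne_zero.2 (hne p))]
  have key := H.shapeOperator_perp_of_isClosedConformal hint hZ hF hne hc
  refine ⟨⟨_, ?_, fun p hp ↦ Module.End.hasEigenvector_iff.2
    ⟨Module.End.mem_eigenspace_iff.2 (key p), hp⟩⟩, fun ξ N hF' p ↦ ?_⟩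
  · intro p
    have hZs := H.smoothAlongAt_of_isClosedConformal hZ p
    have hE := (g.contMDiffAt_form hZs hZs).continuousAt
    -- The principal curvature contains the sign of `g(Z, Z)`, smooth because it is locally constant
    -- where `g(Z, Z)` has no zero.
    have hsign : (fun p ↦ Real.sign (g.form (H.imm p) (Z (H.imm p)) (Z (H.imm p)))) =ᶠ[𝓝 p]
        fun _ ↦ Real.sign (g.form (H.imm p) (Z (H.imm p)) (Z (H.imm p))) := by
      rcases lt_or_gt_of_ne (hne p) with h | h
      · filter_upwards [hE.eventually_lt_const h] with p' hp'
        rw [Real.sign_of_neg hp', Real.sign_of_neg h]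
      · filter_upwards [hE.eventually_const_lt h] with p' hp'
        rw [Real.sign_of_pos hp', Real.sign_of_pos h]
    have hφ : ContMDiffAt (𝓡 (n + 1)) 𝓘(ℝ, ℝ) ∞ (fun p ↦ φ (H.imm p)) p :=
      (hZ.smooth_fun (H.imm p)).comp p (H.isImmersion.contMDiff p)
    have hs : ContMDiffAt (𝓡 (n + 1)) 𝓘(ℝ, ℝ) ∞
        (fun p ↦ Real.sign (g.form (H.imm p) (Z (H.imm p)) (Z (H.imm p)))) p :=
      contMDiffAt_const.congr_of_eventuallyEq hsign
    exact (((contMDiffAt_const.mul hs).mul hφ).neg :)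
  · rw [key p]
    congr 1
    -- In any other frame the individual angles may vary, but twice their product is still `2ab`.
    have h1 := hF'.two_mul_angle_mul_angle p (Z (H.imm p))
    rw [hc p, mul_div_cancel_right₀ _ (abs_ne_zero.2 (hne p))] at h1
    rw [← h1]
    ring
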